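/- Consider the following game between two traders $i\in\{1,2\}$ over times $t=1,\dots,T$ ($T\ge 1$), with time-homogeneous parameters $\lambda>0$, $\alpha,\beta\in[0,1]$, $\rho\ge 0$ with $\alpha e^{-\rho}+\beta<1$, $\gamma^1,\gamma^2>0$, $\sigma^{\mathcal I}\in\mathbb R$, $\sigma^\epsilon>0$, $\rho^{\mathcal I,\epsilon}\in(-1,1)$. The noise pairs $(\omega_t,\epsilon_t)$, $t=1,\dots,T$, are independent over time and, for each $t$, jointly Gaussian with $\omega_t\sim N(0,1)$, $\epsilon_t\sim N(0,(\sigma^\epsilon)^2)$ and $\mathrm{Cov}(\omega_t,\epsilon_t)=\rho^{\mathcal I,\epsilon}\sigma^\epsilon$. The environment is i.i.d. Gaussian, $\mathcal I_t=\sigma^{\mathcal I}\omega_t$ (i.e. $a^{\mathcal I}=b^{\mathcal I}=0$ in $\mathcal I_{t}=a^{\mathcal I}-b^{\mathcal I}\mathcal I_{t-1}+\sigma^{\mathcal I}\omega_{t}$). The state at time $t$ is $s_t=(W^1_t,W^2_t,P_t,\overline Q^1_t,\overline Q^2_t,R_t,\mathcal I_{t-1})\in\mathbb R^7$, and when the traders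 submit orders $q^1_t,q^2_t\in\mathbb R$ it evolves by $$W^i_{t+1}=W^i_t-\{P_t+\lambda(q^1_t+q^2_t)\}q^i_t,\qquad \overline Q^i_{t+1}=\overline Q^i_t-q^i_t,\qquad R_{t+1}=e^{-\rho}\{R_t+\alpha\lambda(q^1_t+q^2_t)\},$$ $$P_{t+1}=P_t-(1-e^{-\rho})R_t+(\alpha e^{-\rho}+\beta)\lambda(q^1_t+q^2_t)+\mathcal I_t+\epsilon_t .$$ A Markov strategy of trader $i$ is a sequence of Borel maps $q^i_t=f^i_t(s_t)$, $t=1,\dots,T$. Trader $i$ maximizes the expected value of the terminal utility, which is $-\exp(-\gamma^iW^i_{T+1})$ if $\overline Q^i_{T+1}=0$ and $-\infty$ otherwise. A Markov perfect equilibrium is a pair of Markov strategies such that, from every time $t\in\{1,\dots,T\}$ and every state in $\mathbb R^7$, neither trader can increase the expected utility by switching to another Markov strategy from time $t$ on. Then there are real numbers $a^i_t,b^i_t,c^i_t,d^i_t$ ($i\in\{1,2\}$, $1\le t\le T$), depending only on the parameters, such that the following holds. A Markov perfect equilibrium exists, and at every Markov perfect equilibrium the order of trader $i$ at time $t$ is,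 for every state ($j\ne i$), $$q^{i*}_t=a^i_t+b^i_t\,\overline Q^i_t+c^i_t\,\overline Q^j_t+d^i_t\,R_t .$$ In particular, the environment has no direct effect on the equilibrium strategy: $q^{i*}_t$ does not depend on the component $\mathcal I_{t-1}$ of the state. -/

import Mathlib

open MeasureTheory ProbabilityTheory

/-- Parameters of the two-trader execution game, all time-homogeneous.
The traders `i ∈ {1, 2}` are indexed by `Fin 2`. -/
structure ExecutionGame where
  /-- number `T` of trading times `1, …, T` -/
  T : ℕ
  T_pos : 1 ≤ T
  /-- instantaneous price impact `λ` of one unit -/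
  lam : ℝ
  lam_pos : 0 < lam
  /-- temporary impact coefficient `α` -/
  α : ℝ
  α_nonneg : 0 ≤ α
  α_le_one : α ≤ 1
  /-- permanent impact coefficient `β` -/
  β : ℝ
  β_nonneg : 0 ≤ β
  β_le_one : β ≤ 1
  /-- resilience speed `ρ` -/
  ρ : ℝ
  ρ_nonneg : 0 ≤ ρ
  impact_lt_one : α * Real.exp (-ρ) + β < 1
  /-- absolute risk aversions `γ¹, γ²` -/
  γ : Fin 2 → ℝ
  γ_pos : ∀ i, 0 < γ i
  /-- coefficients of the environment `I (t+1) = (aI - bI * I t) + σI * ω (t+1)` -/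
  aI : ℝ
  bI : ℝ
  σI : ℝ
  /-- standard deviation of the public news `ε t` -/
  σε : ℝ
  σε_pos : 0 < σε
  /-- correlation of the environment and the public news -/
  corr : ℝ
  neg_one_lt_corr : -1 < corr
  corr_lt_one : corr < 1

namespace ExecutionGame

/-- The state `(W¹, W², P, Q̄¹, Q̄², R, I)` at time `t`; the last component is the environment
at time `t - 1`. -/
structure State where
  W : Fin 2 → ℝ
  P : ℝ
  Q : Fin 2 → ℝ
  R : ℝ
  I : ℝ

/-- The state space carries the Borel σ-algebra of `ℝ⁷`, pulled back along the coordinates. -/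
instance : MeasurableSpace State :=
  MeasurableSpace.comap (fun s : State => (s.W, s.P, s.Q, s.R, s.I)) inferInstance

/-- The opponent of trader `i`. -/
def other (i : Fin 2) : Fin 2 := 1 - i

/-- A profile gives, for each trader and each time, a map from states to orders.
Only the times `1, …, T` matter. -/
abbrev Profile := Fin 2 → ℕ → State → ℝ

/-- The Markov execution strategies of one trader: the decision rules at times `1, …, T` are Borel
measurable. -/
def IsMarkovStrategy (G : ExecutionGame) (f : ℕ → State → ℝ) : Prop :=
  ∀ t ∈ Set.Icc 1 G.T, Measurable (f t)

noncomputable section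

/-- One transition: from state `s`, with orders `q` and noise values `(w, e)` of `(ω t, ε t)`. -/
def next (G : ExecutionGame) (s : State) (q : Fin 2 → ℝ) (w e : ℝ) : State where
  W := fun i => s.W i - (s.P + G.lam * (q 0 + q 1)) * q i
  P := s.P - (1 - Real.exp (-G.ρ)) * s.R
        + (G.α * Real.exp (-G.ρ) + G.β) * G.lam * (q 0 + q 1)
        + ((G.aI - G.bI * s.I) + G.σI * w) + e
  Q := fun i => s.Q i - q i
  R := Real.exp (-G.ρ) * (s.R + G.α * G.lam * (q 0 + q 1))
  I := (G.aI - G.bI * s.I) + G.σI * w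

/-- The state at time `t + n` when the game is in state `s` at time `t`, the traders use the
profile `π`, and the noise takes the values `w u`, `e u` at time `u`. -/
def path (G : ExecutionGame) (π : Profile) (w e : ℕ → ℝ) (t : ℕ) (s : State) : ℕ → State
  | 0 => s
  | n + 1 =>
      G.next (path G π w e t s n) (fun i => π i (t + n) (path G π w e t s n))
        (w (t + n)) (e (t + n))

open Classical in
/-- Terminal utility of trader `i`: CARA utility of wealth if the whole order has been executed,
and `-∞` otherwise. -/
def utility (G : ExecutionGame) (i : Fin 2) (s : State) : EReal :=
  if s.Q i = 0 then ((-Real.exp (-G.γ i * s.W i) : ℝ) : EReal) else ⊥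

/-- Expected terminal utility of trader `i` when the game is in state `s` at time `t` and the
profile `π` is used from then on. As the utility takes values in `[-∞, 0]`, its expectation always
exists in `[-∞, 0]`: it is minus the Lebesgue integral of minus the utility. -/
def value (G : ExecutionGame) {Ω : Type*} [MeasurableSpace Ω] (P : Measure Ω) (ω ε : ℕ → Ω → ℝ)
    (π : Profile) (i : Fin 2) (t : ℕ) (s : State) : EReal :=
  -((∫⁻ x, (-(G.utility i
      (G.path π (fun u => ω u x) (fun u => ε u x) t s (G.T + 1 - t)))).toENNReal ∂P : ENNReal) :
    EReal)

end

/-- The noise `(ω t, ε t)`, `t = 1, …, T`: independent over time, jointly Gaussian at each time,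
`ω t ∼ N(0, 1)`, `ε t ∼ N(0, σε²)`, with covariance `corr * σε` (so that the pair `(σI * ω t, ε t)`
has covariance `corr * σI * σε`). -/
structure IsNoise (G : ExecutionGame) {Ω : Type*} [MeasurableSpace Ω] (P : Measure Ω)
    (ω ε : ℕ → Ω → ℝ) : Prop where
  measurable_ω : ∀ t ∈ Set.Icc 1 G.T, Measurable (ω t)
  measurable_ε : ∀ t ∈ Set.Icc 1 G.T, Measurable (ε t)
  indep : iIndepFun (fun (t : Set.Icc 1 G.T) x => (ω t x, ε t x)) P
  gaussian : ∀ t ∈ Set.Icc 1 G.T, HasGaussianLaw (fun x => (ω t x, ε t x)) P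
  law_ω : ∀ t ∈ Set.Icc 1 G.T, HasLaw (ω t) (gaussianReal 0 1) P
  law_ε : ∀ t ∈ Set.Icc 1 G.T, HasLaw (ε t) (gaussianReal 0 (Real.toNNReal (G.σε ^ 2))) P
  cov : ∀ t ∈ Set.Icc 1 G.T, cov[ω t, ε t; P] = G.corr * G.σε

/-- Markov perfect equilibrium: from every time and every state, no trader gains by switching to
another Markov strategy, the other trader's strategy being fixed. -/
structure IsMarkovPerfect (G : ExecutionGame) {Ω : Type*} [MeasurableSpace Ω] (P : Measure Ω)
    (ω ε : ℕ → Ω → ℝ) (π : Profile) : Prop where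
  markov : ∀ i, G.IsMarkovStrategy (π i)
  optimal : ∀ t ∈ Set.Icc 1 G.T, ∀ s : State, ∀ i, ∀ f, G.IsMarkovStrategy f →
    G.value P ω ε (Function.update π i f) i t s ≤ G.value P ω ε π i t s

end ExecutionGame

/-! The proof is by backward induction. With exponential utility and Gaussian noise, each trader's
certainty-equivalent terminal wealth is `W - P * Q̄ - C`, with `C` a quadratic form in the
inventories and `R` alone. One period adds to `C` the instantaneous impact cost, the expected price
drift on the residual inventory, and a risk charge on its square (`bellman`,
`IsNoise.lintegral_ceLoss_next`). When `aI = bI = 0` the past environment does not enter the price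
increment, so it never enters `C`.

Each period is thus a two-player quadratic game, whose first-order conditions are linear in the
orders. The crux is that this system is always nonsingular. A solution of the homogeneous system is
an equilibrium from zero inventories and zero `R`. There either trader can abstain at cost at most
zero, so both equilibrium costs are nonpositive; yet any nonzero trade has positive joint cost, so
the solution vanishes. `IsAdmissible` records the two properties used, and `IsAdmissible.stageCost`
passes them to the preceding period.

Hence each period has exactly one equilibrium, linear in the reduced state.
`IsNoise.expectedLoss_eqProfile` shows that the resulting profile is optimal against all deviations,
and `IsMarkovPerfect.eq_eqOrder` that one-shot deviations by constants already exclude every other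
equilibrium. -/

namespace ExecutionGame

/-! ### The one-period cost as a quadratic form -/

/-- The payoff-relevant part `((Q̄¹, Q̄²), R)` of the state. -/
abbrev Reduced := (Fin 2 → ℝ) × ℝ

/-- The payoff-relevant part of a state. -/
def State.reduced (s : State) : Reduced := (s.Q, s.R)

lemma sum_fin_two_eq_add_other (g : Fin 2 → ℝ) (i : Fin 2) : g 0 + g 1 = g i + g (other i) := by
  fin_cases i
  · rfl
  · exact add_comm _ _

lemma other_ne (i : Fin 2) : other i ≠ i := by
  fin_cases i <;> decide

noncomputable section

/-- Conditional variance of the one-period price innovation `σI * ω + ε`. -/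
def noiseVar (G : ExecutionGame) : ℝ := G.σI ^ 2 + 2 * G.corr * G.σI * G.σε + G.σε ^ 2

lemma noiseVar_pos (G : ExecutionGame) : 0 < G.noiseVar := by
  have h : G.noiseVar = (G.σI + G.corr * G.σε) ^ 2 + G.σε ^ 2 * ((1 - G.corr) * (1 + G.corr)) := by
    unfold noiseVar; ring
  have := G.σε_pos
  have h1 : 0 < 1 - G.corr := sub_pos.2 G.corr_lt_one
  have h2 : 0 < 1 + G.corr := by linarith [G.neg_one_lt_corr]
  rw [h]
  positivity

/-- The noise-free transition of the reduced state. -/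
def reducedNext (G : ExecutionGame) : Reduced × (Fin 2 → ℝ) →ₗ[ℝ] Reduced where
  toFun z := (z.1.1 - z.2, Real.exp (-G.ρ) * (z.1.2 + G.α * G.lam * (z.2 0 + z.2 1)))
  map_add' x y := by
    ext
    · simp; ring
    · simp; ring
  map_smul' c x := by
    ext
    · simp; ring
    · simp; ring

/-- The total order, as a linear form. -/
def totalOrder : Reduced × (Fin 2 → ℝ) →ₗ[ℝ] ℝ where
  toFun z := z.2 0 + z.2 1
  map_add' x y := by simp; ring
  map_smul' c x := by simp; ring

/-- The order of trader `i`, as a linear form. -/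
def order (i : Fin 2) : Reduced × (Fin 2 → ℝ) →ₗ[ℝ] ℝ where
  toFun z := z.2 i
  map_add' x y := by simp
  map_smul' c x := by simp

/-- The inventory of trader `i` that remains after the current order, as a linear form. -/
def residual (i : Fin 2) : Reduced × (Fin 2 → ℝ) →ₗ[ℝ] ℝ where
  toFun z := z.1.1 i - z.2 i
  map_add' x y := by simp; ring
  map_smul' c x := by simp; ring

/-- The expected price increment over one period, as a linear form. -/
def drift (G : ExecutionGame) : Reduced × (Fin 2 → ℝ) →ₗ[ℝ] ℝ where
  toFun z := -(1 - Real.exp (-G.ρ)) * z.1.2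
    + (G.α * Real.exp (-G.ρ) + G.β) * G.lam * (z.2 0 + z.2 1)
  map_add' x y := by simp; ring
  map_smul' c x := by simp; ring

/-- Certainty-equivalent execution cost of trader `i`, in excess of the mark-to-market value of
the inventory, when the excess cost from the next period on is `C`. -/
def bellman (G : ExecutionGame) (i : Fin 2) (C : QuadraticForm ℝ Reduced) :
    QuadraticForm ℝ (Reduced × (Fin 2 → ℝ)) :=
  G.lam • QuadraticMap.linMulLin totalOrder (order i)
    + QuadraticMap.linMulLin G.drift (residual i)
    + (G.γ i * G.noiseVar / 2) • QuadraticMap.linMulLin (residual i) (residual i)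
    + C.comp G.reducedNext

lemma bellman_apply (G : ExecutionGame) (i : Fin 2) (C : QuadraticForm ℝ Reduced) (x : Reduced)
    (q : Fin 2 → ℝ) :
    G.bellman i C (x, q) = G.lam * (q 0 + q 1) * q i
      + (-(1 - Real.exp (-G.ρ)) * x.2
        + (G.α * Real.exp (-G.ρ) + G.β) * G.lam * (q 0 + q 1)) * (x.1 i - q i)
      + G.γ i * G.noiseVar / 2 * (x.1 i - q i) ^ 2
      + C (x.1 - q, Real.exp (-G.ρ) * (x.2 + G.α * G.lam * (q 0 + q 1))) := by
  simp [bellman, totalOrder, order, residual, drift, reducedNext]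
  ring

/-! ### Absence of profitable manipulation -/

/-- A lower bound for the joint execution cost that rules out profitable price manipulation. It is
stated for `R = α * lam * z`. -/
def impactPotential (G : ExecutionGame) (X z : ℝ) : ℝ :=
  G.lam * (G.β * X ^ 2 / 2 - G.α * z * X - G.α * z ^ 2 / 2)

/-- Continuation costs that leave no room for manipulation: a trader without inventory has no
positive cost, and the joint cost is bounded below by the impact potential. -/
structure IsAdmissible (G : ExecutionGame) (C : Fin 2 → QuadraticForm ℝ Reduced) : Prop where
  nonpos : ∀ i (x : Reduced), x.1 i = 0 → C i x ≤ 0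
  potential_le : ∀ (Q : Fin 2 → ℝ) (z : ℝ),
    G.impactPotential (Q 0 + Q 1) z ≤ C 0 (Q, G.α * G.lam * z) + C 1 (Q, G.α * G.lam * z)

/-- The inventory of trader `i`, as a linear form. -/
def inventory (i : Fin 2) : Reduced →ₗ[ℝ] ℝ where
  toFun x := x.1 i
  map_add' x y := by simp
  map_smul' c x := by simp

/-- The cost of executing the whole remaining inventory at once. -/
def terminalCost (G : ExecutionGame) (i : Fin 2) : QuadraticForm ℝ Reduced :=
  G.lam • QuadraticMap.linMulLin (inventory 0 + inventory 1) (inventory i)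

lemma terminalCost_apply (G : ExecutionGame) (i : Fin 2) (x : Reduced) :
    G.terminalCost i x = G.lam * (x.1 0 + x.1 1) * x.1 i := by
  simp [terminalCost, inventory]
  ring

lemma isAdmissible_terminalCost (G : ExecutionGame) : G.IsAdmissible G.terminalCost where
  nonpos i x hx := by simp [terminalCost_apply, hx]
  potential_le Q z := by
    -- This is the exact gap between the joint terminal cost and the potential, after completing the
    -- square.
    have h : 0 ≤ G.lam * (G.α / 2 * (Q 0 + Q 1 + z) ^ 2
        + ((1 - G.α) + (1 - G.β)) / 2 * (Q 0 + Q 1) ^ 2) := by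
      have := G.lam_pos
      have := G.α_nonneg
      have := sub_nonneg.2 G.α_le_one
      have := sub_nonneg.2 G.β_le_one
      positivity
    simp only [terminalCost_apply, impactPotential]
    nlinarith [h]

/-- One period decreases the impact potential by at most the joint cost of that period. -/
lemma IsAdmissible.potential_add_le_bellman {G : ExecutionGame}
    {C : Fin 2 → QuadraticForm ℝ Reduced} (hC : G.IsAdmissible C) (Q : Fin 2 → ℝ) (z : ℝ) (q : Fin 2 → ℝ) :
    G.impactPotential (Q 0 + Q 1) z
      + G.noiseVar / 2 * (G.γ 0 * (Q 0 - q 0) ^ 2 + G.γ 1 * (Q 1 - q 1) ^ 2)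
      ≤ G.bellman 0 (C 0) ((Q, G.α * G.lam * z), q)
        + G.bellman 1 (C 1) ((Q, G.α * G.lam * z), q) := by
  -- The form `R = α * lam * z` survives a transition, with the new `z` equal to `e^{-ρ}` times old
  -- `z` plus total order. No division by `α` is needed, so `α = 0` is covered.
  have h := hC.potential_le (Q - q) (Real.exp (-G.ρ) * (z + (q 0 + q 1)))
  have hR : G.α * G.lam * (Real.exp (-G.ρ) * (z + (q 0 + q 1)))
      = Real.exp (-G.ρ) * (G.α * G.lam * z + G.α * G.lam * (q 0 + q 1)) := by ring
  rw [hR] at h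
  have hδ : Real.exp (-G.ρ) ≤ 1 := by simpa using G.ρ_nonneg
  have hδ' : 0 < Real.exp (-G.ρ) := Real.exp_pos _
  simp only [bellman_apply]
  generalize C 0 _ = c₀ at *
  generalize C 1 _ = c₁ at *
  generalize Real.exp (-G.ρ) = δ at *
  -- With the continuation costs bounded by the potential, this is exactly the remaining gap; it
  -- uses `α, β ≤ 1` and `δ ≤ 1`.
  have h' : 0 ≤ G.lam * (((1 - G.α) + (1 - G.β)) / 2 * (q 0 + q 1) ^ 2
      + G.α * ((1 - δ) * (1 + δ)) / 2 * (z + (q 0 + q 1)) ^ 2) := by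
    have := G.lam_pos
    have := G.α_nonneg
    have := sub_nonneg.2 G.α_le_one
    have := sub_nonneg.2 G.β_le_one
    have := sub_nonneg.2 hδ
    positivity
  simp only [impactPotential, Pi.sub_apply] at *
  linear_combination h + h'

/-- A trader without inventory who does not trade has no positive cost. -/
lemma IsAdmissible.bellman_nonpos {G : ExecutionGame} {C : Fin 2 → QuadraticForm ℝ Reduced}
    (hC : G.IsAdmissible C) {i : Fin 2} {x : Reduced} {q : Fin 2 → ℝ} (hx : x.1 i = 0)
    (hq : q i = 0) : G.bellman i (C i) (x, q) ≤ 0 := by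
  rw [bellman_apply, hx, hq]
  simpa using hC.nonpos i (x.1 - q, _) (by simp [hx, hq])

/-- From the empty reduced state, any trade has a positive joint cost. -/
lemma IsAdmissible.bellman_zero_pos {G : ExecutionGame} {C : Fin 2 → QuadraticForm ℝ Reduced}
    (hC : G.IsAdmissible C) {q : Fin 2 → ℝ} (hq : q ≠ 0) :
    0 < G.bellman 0 (C 0) (0, q) + G.bellman 1 (C 1) (0, q) := by
  have h := hC.potential_add_le_bellman 0 0 q
  simp only [impactPotential, Pi.zero_apply, mul_zero, zero_sub] at h
  change _ ≤ G.bellman 0 (C 0) (0, q) + G.bellman 1 (C 1) (0, q) at h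
  refine lt_of_lt_of_le ?_ h
  have hv := G.noiseVar_pos
  have h0 := G.γ_pos 0
  have h1 := G.γ_pos 1
  have : q 0 ≠ 0 ∨ q 1 ≠ 0 := by
    by_contra! hcon
    exact hq (by ext i; fin_cases i; exacts [hcon.1, hcon.2])
  have hpos : 0 < G.γ 0 * (-q 0) ^ 2 + G.γ 1 * (-q 1) ^ 2 := by
    rcases this with h | h
    · exact add_pos_of_pos_of_nonneg (mul_pos h0 (sq_pos_of_ne_zero (neg_ne_zero.2 h)))
        (by positivity)
    · exact add_pos_of_nonneg_of_pos (by positivity)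
        (mul_pos h1 (sq_pos_of_ne_zero (neg_ne_zero.2 h)))
  simp only [add_zero, ne_eq, OfNat.ofNat_ne_zero, not_false_eq_true, zero_pow, mul_zero,
    zero_div, sub_zero, zero_add]
  exact mul_pos (half_pos hv) hpos

/-- The cost of a trader is strictly convex in the trader's own order. -/
lemma IsAdmissible.bellman_single_pos {G : ExecutionGame} {C : Fin 2 → QuadraticForm ℝ Reduced}
    (hC : G.IsAdmissible C) (i : Fin 2) : 0 < G.bellman i (C i) (0, Pi.single i 1) := by
  have h := hC.bellman_zero_pos (q := Pi.single i (1 : ℝ)) (by simp)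
  rw [sum_fin_two_eq_add_other (fun k => G.bellman k (C k) (0, Pi.single i 1)) i] at h
  -- The idle opponent bears no positive cost, so the positive joint cost falls on trader `i`.
  have := hC.bellman_nonpos (i := other i) (x := 0) (q := Pi.single i (1 : ℝ)) rfl
    (by simp [other_ne])
  linarith

/-! ### Equilibria of the one-period game -/

/-- The orders `q` form a Nash equilibrium of the one-period game with continuation costs `C`. -/
def IsStageEquilibrium (G : ExecutionGame) (C : Fin 2 → QuadraticForm ℝ Reduced) (x : Reduced)
    (q : Fin 2 → ℝ) : Prop :=
  ∀ i y, G.bellman i (C i) (x, q) ≤ G.bellman i (C i) (x, Function.update q i y)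

lemma bellman_update (G : ExecutionGame) (i : Fin 2) (C : QuadraticForm ℝ Reduced) (x : Reduced)
    (q : Fin 2 → ℝ) (y : ℝ) :
    G.bellman i C (x, Function.update q i (q i + y)) = G.bellman i C (x, q)
      + y * QuadraticMap.polar (G.bellman i C) (x, q) (0, Pi.single i 1)
      + y ^ 2 * G.bellman i C (0, Pi.single i 1) := by
  have h : ((x, Function.update q i (q i + y)) : Reduced × (Fin 2 → ℝ))
      = (x, q) + y • (0, Pi.single i 1) := by
    refine Prod.ext (by simp) (funext fun k => ?_)
    by_cases hk : k = i
    · subst hk; simp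
    · simp [hk]
  rw [h, QuadraticMap.map_add (G.bellman i C), QuadraticMap.map_smul,
    QuadraticMap.polar_smul_right, smul_eq_mul, smul_eq_mul]
  ring

/-- First-order conditions characterize the one-period equilibria. -/
lemma IsAdmissible.isStageEquilibrium_iff {G : ExecutionGame} {C : Fin 2 → QuadraticForm ℝ Reduced}
    (hC : G.IsAdmissible C) (x : Reduced) (q : Fin 2 → ℝ) :
    G.IsStageEquilibrium C x q ↔
      ∀ i, QuadraticMap.polar (G.bellman i (C i)) (x, q) (0, Pi.single i 1) = 0 := by
  refine forall_congr' fun i => ?_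
  have hpos := hC.bellman_single_pos i
  set A := G.bellman i (C i) (0, Pi.single i 1)
  set D := QuadraticMap.polar (G.bellman i (C i)) (x, q) (0, Pi.single i 1) with hD
  constructor
  · intro h
    -- The deviation goes to the vertex of the parabola, which would gain `D ^ 2 / (4 * A)`.
    have h1 := h (q i + -(D / (2 * A)))
    rw [bellman_update, ← hD] at h1
    have h2 : -(D / (2 * A)) * D + (-(D / (2 * A))) ^ 2 * A = -(D ^ 2 / (4 * A)) := by
      field_simp; ring
    have h3 : D ^ 2 / (4 * A) ≤ 0 := by linarith
    have h4 : D ^ 2 ≤ 0 := by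
      rwa [div_le_iff₀ (by positivity), zero_mul] at h3
    exact pow_eq_zero_iff two_ne_zero |>.1 (le_antisymm h4 (sq_nonneg D))
  · intro h y
    have h1 := bellman_update G i (C i) x q (y - q i)
    rw [add_sub_cancel, ← hD, h] at h1
    rw [h1]
    have : 0 ≤ (y - q i) ^ 2 * A := by positivity
    linarith

/-- The one-period game has exactly one equilibrium, which is linear in the reduced state. -/
lemma IsAdmissible.exists_stageEquilibrium {G : ExecutionGame}
    {C : Fin 2 → QuadraticForm ℝ Reduced} (hC : G.IsAdmissible C) :
    ∃ φ : Reduced →ₗ[ℝ] (Fin 2 → ℝ), ∀ x q, G.IsStageEquilibrium C x q ↔ q = φ x := by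
  let F : Reduced × (Fin 2 → ℝ) →ₗ[ℝ] (Fin 2 → ℝ) := LinearMap.pi fun i =>
    (QuadraticMap.polarBilin (G.bellman i (C i))).flip (0, Pi.single i 1)
  have hF : ∀ x q, G.IsStageEquilibrium C x q ↔ F (x, q) = 0 := fun x q => by
    rw [hC.isStageEquilibrium_iff, funext_iff]
    rfl
  let M : (Fin 2 → ℝ) →ₗ[ℝ] (Fin 2 → ℝ) := F ∘ₗ LinearMap.inr ℝ _ _
  have hM : Function.Injective M := by
    rw [← LinearMap.ker_eq_bot, LinearMap.ker_eq_bot']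
    intro q hq
    by_contra hne
    have heq : G.IsStageEquilibrium C 0 q := (hF 0 q).2 hq
    -- Deviating to the order `0` is available to each trader.
    have hle : ∀ i, G.bellman i (C i) (0, q) ≤ 0 := fun i =>
      (heq i 0).trans (hC.bellman_nonpos rfl (by simp))
    linarith [hC.bellman_zero_pos hne, hle 0, hle 1]
  let e := LinearEquiv.ofInjectiveEndo M hM
  refine ⟨-(e.symm.toLinearMap ∘ₗ F ∘ₗ LinearMap.inl ℝ _ _), fun x q => ?_⟩
  have hsplit : F (x, q) = F (x, 0) + e q := by
    change _ = _ + F (0, q)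
    rw [← map_add]
    simp
  rw [hF, hsplit, add_comm, add_eq_zero_iff_eq_neg, ← LinearEquiv.eq_symm_apply]
  simp

/-- The linear equilibrium order of the one-period game (zero if the continuation costs admit
manipulation). -/
def stageOrder (G : ExecutionGame) (C : Fin 2 → QuadraticForm ℝ Reduced) :
    Reduced →ₗ[ℝ] (Fin 2 → ℝ) :=
  open Classical in if hC : G.IsAdmissible C then hC.exists_stageEquilibrium.choose else 0

lemma IsAdmissible.isStageEquilibrium_iff_eq {G : ExecutionGame}
    {C : Fin 2 → QuadraticForm ℝ Reduced} (hC : G.IsAdmissible C) (x : Reduced) (q : Fin 2 → ℝ) :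
    G.IsStageEquilibrium C x q ↔ q = G.stageOrder C x := by
  rw [stageOrder, dif_pos hC]
  exact hC.exists_stageEquilibrium.choose_spec x q

/-- The costs of the traders when they play the one-period equilibrium. -/
def stageCost (G : ExecutionGame) (C : Fin 2 → QuadraticForm ℝ Reduced) (i : Fin 2) :
    QuadraticForm ℝ Reduced :=
  (G.bellman i (C i)).comp (LinearMap.prod LinearMap.id (G.stageOrder C))

lemma stageCost_apply (G : ExecutionGame) (C : Fin 2 → QuadraticForm ℝ Reduced) (i : Fin 2)
    (x : Reduced) : G.stageCost C i x = G.bellman i (C i) (x, G.stageOrder C x) := rfl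

/-- A trader without inventory can abstain, so the equilibrium cost is nonpositive. The potential
bound holds for any orders, the risk terms being nonnegative. -/
lemma IsAdmissible.stageCost {G : ExecutionGame} {C : Fin 2 → QuadraticForm ℝ Reduced}
    (hC : G.IsAdmissible C) : G.IsAdmissible (G.stageCost C) where
  nonpos i x hx := by
    rw [stageCost_apply]
    exact ((hC.isStageEquilibrium_iff_eq x _).2 rfl i 0).trans (hC.bellman_nonpos hx (by simp))
  potential_le Q z := by
    simp only [stageCost_apply]
    refine le_trans ?_ (hC.potential_add_le_bellman Q z _)
    have hv := G.noiseVar_pos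
    have h0 := G.γ_pos 0
    have h1 := G.γ_pos 1
    have : ∀ a b : ℝ, 0 ≤ G.noiseVar / 2 * (G.γ 0 * a ^ 2 + G.γ 1 * b ^ 2) := fun a b => by
      positivity
    linarith [this (Q 0 - G.stageOrder C (Q, G.α * G.lam * z) 0)
      (Q 1 - G.stageOrder C (Q, G.α * G.lam * z) 1)]

/-! ### Backward recursion for costs and orders -/

/-- The equilibrium costs when `n` further periods follow the current one. -/
def eqCost (G : ExecutionGame) : ℕ → Fin 2 → QuadraticForm ℝ Reduced
  | 0 => G.terminalCost
  | n + 1 => G.stageCost (eqCost G n)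

/-- The equilibrium orders when `n` further periods follow the current one. -/
def eqOrder (G : ExecutionGame) : ℕ → Reduced →ₗ[ℝ] (Fin 2 → ℝ)
  | 0 => LinearMap.fst ℝ _ _
  | n + 1 => G.stageOrder (G.eqCost n)

lemma isAdmissible_eqCost (G : ExecutionGame) (n : ℕ) : G.IsAdmissible (G.eqCost n) := by
  induction n with
  | zero => exact G.isAdmissible_terminalCost
  | succ n ih => exact ih.stageCost

lemma isStageEquilibrium_eqCost_iff (G : ExecutionGame) (n : ℕ) (x : Reduced) (q : Fin 2 → ℝ) :
    G.IsStageEquilibrium (G.eqCost n) x q ↔ q = G.eqOrder (n + 1) x :=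
  (G.isAdmissible_eqCost n).isStageEquilibrium_iff_eq x q

lemma eqCost_succ_apply (G : ExecutionGame) (n : ℕ) (i : Fin 2) (x : Reduced) :
    G.eqCost (n + 1) i x = G.bellman i (G.eqCost n i) (x, G.eqOrder (n + 1) x) := rfl

end
end ExecutionGame

/-! ### Independence, measurability and trajectories -/

lemma ProbabilityTheory.IndepFun.lintegral_comp_prodMk {Ω A B : Type*} [MeasurableSpace Ω]
    [MeasurableSpace A] [MeasurableSpace B] {P : Measure Ω} [IsProbabilityMeasure P] {X : Ω → A}
    {Y : Ω → B} (h : IndepFun X Y P) (hX : Measurable X) (hY : Measurable Y)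
    {Ψ : A × B → ENNReal} (hΨ : Measurable Ψ) :
    ∫⁻ x, Ψ (X x, Y x) ∂P = ∫⁻ x, ∫⁻ x', Ψ (X x, Y x') ∂P ∂P := by
  have : IsProbabilityMeasure (P.map Y) := Measure.isProbabilityMeasure_map hY.aemeasurable
  have hΨ' : Measurable fun a => ∫⁻ b, Ψ (a, b) ∂P.map Y := hΨ.lintegral_prod_right'
  have hinner : ∀ a, ∫⁻ b, Ψ (a, b) ∂P.map Y = ∫⁻ x', Ψ (a, Y x') ∂P := fun a =>
    lintegral_map (hΨ.comp measurable_prodMk_left) hY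
  rw [← lintegral_map (f := Ψ) hΨ (hX.prodMk hY),
    (indepFun_iff_map_prod_eq_prod_map_map hX.aemeasurable hY.aemeasurable).1 h,
    lintegral_prod _ hΨ.aemeasurable, lintegral_map hΨ' hX]
  simp only [hinner]

namespace ExecutionGame

section Measurability

variable {A : Type*} [MeasurableSpace A]

lemma measurable_state_iff {f : A → State} : Measurable f ↔
    Measurable fun a => ((f a).W, (f a).P, (f a).Q, (f a).R, (f a).I) :=
  measurable_comap_iff

lemma measurable_state_tuple : Measurable fun s : State => (s.W, s.P, s.Q, s.R, s.I) :=
  measurable_state_iff.1 measurable_id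

@[fun_prop]
lemma State.measurable_W : Measurable State.W := measurable_state_tuple.fst

@[fun_prop]
lemma State.measurable_P : Measurable State.P := measurable_state_tuple.snd.fst

@[fun_prop]
lemma State.measurable_Q : Measurable State.Q := measurable_state_tuple.snd.snd.fst

@[fun_prop]
lemma State.measurable_R : Measurable State.R := measurable_state_tuple.snd.snd.snd.fst

@[fun_prop]
lemma State.measurable_I : Measurable State.I := measurable_state_tuple.snd.snd.snd.snd

lemma State.measurable_reduced : Measurable State.reduced :=
  State.measurable_Q.prodMk State.measurable_R

lemma measurable_next (G : ExecutionGame) {s : A → State} {q : A → Fin 2 → ℝ} {w e : A → ℝ}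
    (hs : Measurable s) (hq : Measurable q) (hw : Measurable w) (he : Measurable e) :
    Measurable fun a => G.next (s a) (q a) (w a) (e a) := by
  rw [measurable_state_iff]
  unfold next
  have hW := State.measurable_W.comp hs
  have hQ := State.measurable_Q.comp hs
  have hP := State.measurable_P.comp hs
  have hR := State.measurable_R.comp hs
  have hI := State.measurable_I.comp hs
  have hWi := fun i => (measurable_pi_apply i).comp hW
  have hQi := fun i => (measurable_pi_apply i).comp hQ
  have hqi := fun i => (measurable_pi_apply i).comp hq
  simp only [Function.comp_def] at *
  refine Measurable.prodMk (measurable_pi_lambda _ fun i => ?_) (Measurable.prodMk ?_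
    (Measurable.prodMk (measurable_pi_lambda _ fun i => ?_) (Measurable.prodMk ?_ ?_)))
  · exact (hWi i).sub ((hP.add (((hqi 0).add (hqi 1)).const_mul _)).mul (hqi i))
  · exact (((hP.sub (hR.const_mul _)).add (((hqi 0).add (hqi 1)).const_mul _)).add
      ((measurable_const.sub (hI.const_mul _)).add (hw.const_mul _))).add he
  · exact (hQi i).sub (hqi i)
  · exact (hR.add (((hqi 0).add (hqi 1)).const_mul _)).const_mul _
  · exact (measurable_const.sub (hI.const_mul _)).add (hw.const_mul _)

lemma measurable_path (G : ExecutionGame) {π : Profile} {w e : A → ℕ → ℝ} {t : ℕ}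
    {s : A → State} (hs : Measurable s) (hw : ∀ u, Measurable fun a => w a u)
    (he : ∀ u, Measurable fun a => e a u) (n : ℕ)
    (hπ : ∀ u ∈ Set.Ico t (t + n), ∀ i, Measurable (π i u)) :
    Measurable fun a => G.path π (w a) (e a) t (s a) n := by
  induction n with
  | zero => exact hs
  | succ n ih =>
    have ih := ih fun u hu => hπ u ⟨hu.1, by have := hu.2; omega⟩
    exact G.measurable_next ih (measurable_pi_lambda _ fun i =>
      (hπ (t + n) ⟨by omega, by omega⟩ i).comp ih) (hw _) (he _)

end Measurability

section Path

variable (G : ExecutionGame)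

lemma path_congr {π π' : Profile} {w w' e e' : ℕ → ℝ} {t : ℕ} (s : State) (n : ℕ)
    (hπ : ∀ u ∈ Set.Ico t (t + n), ∀ i, π i u = π' i u)
    (hw : ∀ u ∈ Set.Ico t (t + n), w u = w' u) (he : ∀ u ∈ Set.Ico t (t + n), e u = e' u) :
    G.path π w e t s n = G.path π' w' e' t s n := by
  induction n with
  | zero => rfl
  | succ n ih =>
    have hsub : ∀ u ∈ Set.Ico t (t + n), u ∈ Set.Ico t (t + (n + 1)) :=
      fun u hu => ⟨hu.1, by have := hu.2; omega⟩
    have hmem : t + n ∈ Set.Ico t (t + (n + 1)) := ⟨by omega, by omega⟩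
    have ih := ih (fun u hu => hπ u (hsub u hu)) (fun u hu => hw u (hsub u hu))
      (fun u hu => he u (hsub u hu))
    simp only [path, ih, hw _ hmem, he _ hmem, hπ _ hmem]

lemma path_succ_eq_path_next (π : Profile) (w e : ℕ → ℝ) (t : ℕ) (s : State) (n : ℕ) :
    G.path π w e t s (n + 1)
      = G.path π w e (t + 1) (G.next s (fun i => π i t s) (w t) (e t)) n := by
  induction n with
  | zero => rfl
  | succ n ih =>
    rw [path, ih, show t + (n + 1) = t + 1 + n by omega]
    rfl

end Path

/-! ### Expected losses and the Gaussian innovation -/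

noncomputable section

open Classical in
/-- The terminal loss: minus the terminal utility. -/
def loss (G : ExecutionGame) (i : Fin 2) (s : State) : ENNReal :=
  if s.Q i = 0 then ENNReal.ofReal (Real.exp (-G.γ i * s.W i)) else ⊤

lemma toENNReal_neg_utility (G : ExecutionGame) (i : Fin 2) (s : State) :
    (-(G.utility i s)).toENNReal = G.loss i s := by
  unfold utility loss
  split_ifs with h
  · rw [← EReal.coe_neg, neg_neg, EReal.toENNReal_of_ne_top (EReal.coe_ne_top _), EReal.toReal_coe]
  · simp

lemma measurable_loss (G : ExecutionGame) (i : Fin 2) : Measurable (G.loss i) := by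
  have hW : Measurable fun s : State => s.W i := (measurable_pi_apply i).comp State.measurable_W
  have hQ : Measurable fun s : State => s.Q i := (measurable_pi_apply i).comp State.measurable_Q
  exact Measurable.ite (hQ (measurableSet_singleton 0))
    (Real.measurable_exp.comp (hW.const_mul _)).ennreal_ofReal measurable_const

variable {Ω : Type*} [MeasurableSpace Ω]

/-- Expected terminal loss of trader `i` after `n` periods, from state `s` at time `t`. -/
def expectedLoss (G : ExecutionGame) (P : Measure Ω) (ω ε : ℕ → Ω → ℝ) (π : Profile) (i : Fin 2)
    (t n : ℕ) (s : State) : ENNReal :=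
  ∫⁻ x, G.loss i (G.path π (fun u => ω u x) (fun u => ε u x) t s n) ∂P

lemma value_eq_neg_expectedLoss (G : ExecutionGame) (P : Measure Ω) (ω ε : ℕ → Ω → ℝ)
    (π : Profile) (i : Fin 2) (t : ℕ) (s : State) :
    G.value P ω ε π i t s = -(G.expectedLoss P ω ε π i t (G.T + 1 - t) s : EReal) := by
  simp only [value, expectedLoss, toENNReal_neg_utility]

lemma value_le_value_iff (G : ExecutionGame) (P : Measure Ω) (ω ε : ℕ → Ω → ℝ)
    (π π' : Profile) (i : Fin 2) (t : ℕ) (s : State) :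
    G.value P ω ε π' i t s ≤ G.value P ω ε π i t s ↔
      G.expectedLoss P ω ε π i t (G.T + 1 - t) s
        ≤ G.expectedLoss P ω ε π' i t (G.T + 1 - t) s := by
  rw [value_eq_neg_expectedLoss, value_eq_neg_expectedLoss, EReal.neg_le_neg_iff,
    EReal.coe_ennreal_le_coe_ennreal_iff]

lemma expectedLoss_congr (G : ExecutionGame) (P : Measure Ω) (ω ε : ℕ → Ω → ℝ) {π π' : Profile}
    {t n : ℕ} (hπ : ∀ u ∈ Set.Ico t (t + n), ∀ i, π i u = π' i u) (i : Fin 2) (s : State) :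
    G.expectedLoss P ω ε π i t n s = G.expectedLoss P ω ε π' i t n s := by
  unfold expectedLoss
  refine lintegral_congr fun x => ?_
  rw [G.path_congr s n hπ (fun _ _ => rfl) (fun _ _ => rfl)]

lemma expectedLoss_zero (G : ExecutionGame) (P : Measure Ω) [IsProbabilityMeasure P]
    (ω ε : ℕ → Ω → ℝ) (π : Profile) (i : Fin 2) (t : ℕ) (s : State) :
    G.expectedLoss P ω ε π i t 0 s = G.loss i s := by
  simp [expectedLoss, path]

variable {G : ExecutionGame} {P : Measure Ω} {ω ε : ℕ → Ω → ℝ}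

/-- The tower property of the expected terminal loss. -/
lemma IsNoise.expectedLoss_succ [IsProbabilityMeasure P] (hN : G.IsNoise P ω ε) {π : Profile}
    (hπ : ∀ i, G.IsMarkovStrategy (π i)) (i : Fin 2) {t n : ℕ} (ht : 1 ≤ t) (hn : t + n = G.T)
    (s : State) :
    G.expectedLoss P ω ε π i t (n + 1) s = ∫⁻ x, G.expectedLoss P ω ε π i (t + 1) n
      (G.next s (fun k => π k t s) (ω t x) (ε t x)) ∂P := by
  have htT : t ∈ Set.Icc 1 G.T := ⟨ht, by omega⟩
  let f : Set.Icc 1 G.T → Ω → ℝ × ℝ := fun u x => (ω u x, ε u x)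
  have hf : ∀ u, Measurable (f u) := fun u =>
    (hN.measurable_ω u u.2).prodMk (hN.measurable_ε u u.2)
  let S : Finset (Set.Icc 1 G.T) := {⟨t, htT⟩}
  let F : Finset (Set.Icc 1 G.T) := Finset.univ.filter fun u => t < u
  have hdisj : Disjoint S F := by simp [S, F]
  have hindep : IndepFun (f ⟨t, htT⟩) (fun x (u : F) => f u x) P :=
    (hN.indep.indepFun_finset S F hdisj hf).comp
      (measurable_pi_apply (⟨⟨t, htT⟩, Finset.mem_singleton_self _⟩ : S)) measurable_id
  -- The noise is only controlled at times `1, …, T`; the later noise is padded by zero at times the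
  -- path never reads.
  let ext : (F → ℝ × ℝ) → ℕ → ℝ × ℝ := fun η u =>
    if h : u ∈ Set.Icc 1 G.T ∧ t < u then η ⟨⟨u, h.1⟩, by simp [F, h.2]⟩ else 0
  have hext : ∀ u, Measurable fun η => ext η u := fun u => by
    by_cases h : u ∈ Set.Icc 1 G.T ∧ t < u
    · simp only [ext, dif_pos h]
      exact measurable_pi_apply _
    · simp only [ext, dif_neg h]
      exact measurable_const
  have hextY : ∀ x, ∀ u ∈ Set.Ico (t + 1) (t + 1 + n),
      ext (fun v : F => f v x) u = (ω u x, ε u x) := fun x u hu => by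
    have h : u ∈ Set.Icc 1 G.T ∧ t < u := by
      have := hu.1
      have := hu.2
      exact ⟨⟨by omega, by omega⟩, by omega⟩
    simp only [ext, dif_pos h, f]
  let Ψ : (ℝ × ℝ) × (F → ℝ × ℝ) → ENNReal := fun z =>
    G.loss i (G.path π (fun u => (ext z.2 u).1) (fun u => (ext z.2 u).2) (t + 1)
      (G.next s (fun k => π k t s) z.1.1 z.1.2) n)
  have hΨ : Measurable Ψ := by
    refine (G.measurable_loss i).comp (G.measurable_path ?_ ?_ ?_ n ?_)
    · exact G.measurable_next measurable_const measurable_const measurable_fst.fst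
        measurable_fst.snd
    · exact fun u => ((hext u).comp measurable_snd).fst
    · exact fun u => ((hext u).comp measurable_snd).snd
    · intro u hu k
      have := hu.1
      have := hu.2
      exact hπ k u ⟨by omega, by omega⟩
  have hpath : ∀ x x', Ψ (f ⟨t, htT⟩ x, fun u : F => f u x')
      = G.loss i (G.path π (fun u => ω u x') (fun u => ε u x') (t + 1)
          (G.next s (fun k => π k t s) (ω t x) (ε t x)) n) := fun x x' => by
    simp only [Ψ]
    rw [G.path_congr _ n (fun _ _ _ => rfl) (fun u hu => congrArg Prod.fst (hextY x' u hu))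
      (fun u hu => congrArg Prod.snd (hextY x' u hu))]
  have h := hindep.lintegral_comp_prodMk (hf _) (measurable_pi_lambda _ fun u => hf u) hΨ
  simp only [hpath] at h
  simp only [expectedLoss, path_succ_eq_path_next]
  exact h

lemma IsNoise.integral_innovation (hN : G.IsNoise P ω ε) {t : ℕ} (ht : t ∈ Set.Icc 1 G.T) :
    P[fun x => G.σI * ω t x + ε t x] = 0 := by
  have hω : ∫ x, ω t x ∂P = 0 := by
    rw [(hN.law_ω t ht).integral_eq]; simp
  have hε : ∫ x, ε t x ∂P = 0 := by
    rw [(hN.law_ε t ht).integral_eq]; simp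
  rw [integral_add ((hN.gaussian t ht).fst.integrable.const_mul _)
    (hN.gaussian t ht).snd.integrable, integral_const_mul, hω, hε]
  simp

lemma IsNoise.variance_innovation [IsProbabilityMeasure P] (hN : G.IsNoise P ω ε) {t : ℕ}
    (ht : t ∈ Set.Icc 1 G.T) :
    Var[fun x => G.σI * ω t x + ε t x; P] = G.noiseVar := by
  have hω : Var[ω t; P] = 1 := by
    rw [(hN.law_ω t ht).variance_eq]; simp
  have hε : Var[ε t; P] = G.σε ^ 2 := by
    rw [(hN.law_ε t ht).variance_eq]
    simp [Real.coe_toNNReal _ (sq_nonneg G.σε)]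
  rw [variance_fun_add ((hN.gaussian t ht).fst.memLp_two.const_mul _)
    (hN.gaussian t ht).snd.memLp_two, variance_const_mul, covariance_const_mul_left,
    hN.cov t ht, hω, hε, noiseVar]
  ring

lemma IsNoise.hasGaussianLaw_innovation (hN : G.IsNoise P ω ε) {t : ℕ}
    (ht : t ∈ Set.Icc 1 G.T) : HasGaussianLaw (fun x => G.σI * ω t x + ε t x) P :=
  (hN.gaussian t ht).map_fun
    (G.σI • ContinuousLinearMap.fst ℝ ℝ ℝ + ContinuousLinearMap.snd ℝ ℝ ℝ)

lemma IsNoise.lintegral_exp_innovation [IsProbabilityMeasure P] (hN : G.IsNoise P ω ε) {t : ℕ}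
    (ht : t ∈ Set.Icc 1 G.T) (a c : ℝ) :
    ∫⁻ x, ENNReal.ofReal (Real.exp (a + c * (G.σI * ω t x + ε t x))) ∂P
      = ENNReal.ofReal (Real.exp (a + G.noiseVar * c ^ 2 / 2)) := by
  have hlaw := (hN.hasGaussianLaw_innovation ht).map_eq_gaussianReal
  rw [hN.integral_innovation ht, hN.variance_innovation ht] at hlaw
  have hmgf := mgf_gaussianReal hlaw c
  rw [Real.coe_toNNReal _ G.noiseVar_pos.le, zero_mul, zero_add, mgf] at hmgf
  -- A nonintegrable function has integral zero by convention, whereas the Gaussian moment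
  -- generating function is positive.
  have hint : Integrable (fun x => Real.exp (c * (G.σI * ω t x + ε t x))) P := by
    by_contra h
    rw [integral_undef h] at hmgf
    exact (Real.exp_pos _).ne hmgf
  simp only [Real.exp_add a]
  rw [← ofReal_integral_eq_lintegral_ofReal (hint.const_mul _)
    (Filter.Eventually.of_forall fun x => by positivity), integral_const_mul, hmgf]

end
end ExecutionGame

/-! ### Dynamic programming: verification and uniqueness -/

namespace ExecutionGame
noncomputable section

variable {Ω : Type*} [MeasurableSpace Ω] {G : ExecutionGame} {P : Measure Ω}
  {ω ε : ℕ → Ω → ℝ}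

/-- The loss of trader `i` in a state from which the certainty-equivalent terminal wealth is
`W - P * Q̄ - c`. -/
def ceLoss (G : ExecutionGame) (i : Fin 2) (c : ℝ) (s : State) : ENNReal :=
  ENNReal.ofReal (Real.exp (-G.γ i * (s.W i - s.P * s.Q i - c)))

lemma ceLoss_le_ceLoss_iff (G : ExecutionGame) (i : Fin 2) (c c' : ℝ) (s : State) :
    G.ceLoss i c s ≤ G.ceLoss i c' s ↔ c ≤ c' := by
  have := G.γ_pos i
  rw [ceLoss, ceLoss, ENNReal.ofReal_le_ofReal_iff (Real.exp_pos _).le, Real.exp_le_exp,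
    neg_mul, neg_mul, neg_le_neg_iff, mul_le_mul_iff_right₀ this, sub_le_sub_iff_left]

/-- The Bellman equation for exponential losses with a quadratic certainty equivalent. -/
lemma IsNoise.lintegral_ceLoss_next [IsProbabilityMeasure P] (hN : G.IsNoise P ω ε)
    (haI : G.aI = 0) (hbI : G.bI = 0) {t : ℕ} (ht : t ∈ Set.Icc 1 G.T) (i : Fin 2)
    (C : QuadraticForm ℝ Reduced) (s : State) (q : Fin 2 → ℝ) :
    ∫⁻ x, G.ceLoss i (C (G.next s q (ω t x) (ε t x)).reduced) (G.next s q (ω t x) (ε t x)) ∂P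
      = G.ceLoss i (G.bellman i C (s.reduced, q)) s := by
  have hred : ∀ w e, (G.next s q w e).reduced
      = (s.Q - q, Real.exp (-G.ρ) * (s.R + G.α * G.lam * (q 0 + q 1))) := fun w e => rfl
  simp only [hred, bellman_apply]
  simp only [ceLoss, State.reduced]
  generalize C _ = c
  clear hred
  generalize hr : (Real.exp (-G.ρ) : ℝ) = δ at *
  -- The innovation revalues only the residual inventory, hence the coefficient `γ (Q̄ - q)`; the
  -- Gaussian formula then produces the risk charge.
  have h := hN.lintegral_exp_innovation ht
    (-G.γ i * (s.W i - (s.P + G.lam * (q 0 + q 1)) * q i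
      - (s.P - (1 - δ) * s.R + (G.α * δ + G.β) * G.lam * (q 0 + q 1)) * (s.Q i - q i) - c))
    (G.γ i * (s.Q i - q i))
  convert h using 5
  · simp only [next, haI, hbI, hr]
    ring
  · ring

/-- In the last period a trader who does not execute the whole inventory has infinite loss. -/
lemma loss_next (G : ExecutionGame) (i : Fin 2) (s : State) (q : Fin 2 → ℝ) (w e : ℝ) :
    G.loss i (G.next s q w e) = if q i = s.Q i then
      ENNReal.ofReal (Real.exp (-G.γ i * (s.W i - (s.P + G.lam * (q 0 + q 1)) * q i))) else ⊤ := by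
  have h : s.Q i - q i = 0 ↔ q i = s.Q i := sub_eq_zero.trans eq_comm
  simp only [loss, next, h]

lemma loss_next_of_eq (G : ExecutionGame) (i : Fin 2) (s : State) {q : Fin 2 → ℝ}
    (hq : q = s.Q) (w e : ℝ) :
    G.loss i (G.next s q w e) = G.ceLoss i (G.eqCost 0 i s.reduced) s := by
  rw [loss_next, if_pos (congrFun hq i), ceLoss, hq, eqCost, terminalCost_apply]
  congr 3
  simp only [State.reduced]
  ring

/-- Next-period wealth and inventories do not involve the current noise, so the zeros are
placeholders. -/
lemma IsNoise.expectedLoss_one [IsProbabilityMeasure P] (hN : G.IsNoise P ω ε) {π : Profile}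
    (hπ : ∀ i, G.IsMarkovStrategy (π i)) (i : Fin 2) {t : ℕ} (ht : t ∈ Set.Icc 1 G.T)
    (htT : t = G.T) (s : State) :
    G.expectedLoss P ω ε π i t 1 s = G.loss i (G.next s (fun k => π k t s) 0 0) := by
  rw [hN.expectedLoss_succ hπ i ht.1 (by omega)]
  simp [expectedLoss_zero, loss_next]

/-- One step of backward induction. -/
lemma IsNoise.expectedLoss_succ_eq [IsProbabilityMeasure P] (hN : G.IsNoise P ω ε)
    (haI : G.aI = 0) (hbI : G.bI = 0) {π : Profile} (hπ : ∀ i, G.IsMarkovStrategy (π i))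
    (i : Fin 2) {t n : ℕ} (ht : 1 ≤ t) (hn : t + n = G.T) {C : QuadraticForm ℝ Reduced}
    (hC : ∀ s, G.expectedLoss P ω ε π i (t + 1) n s = G.ceLoss i (C s.reduced) s) (s : State) :
    G.expectedLoss P ω ε π i t (n + 1) s
      = G.ceLoss i (G.bellman i C (s.reduced, fun k => π k t s)) s := by
  rw [hN.expectedLoss_succ hπ i ht hn]
  simp only [hC]
  exact hN.lintegral_ceLoss_next haI hbI ⟨ht, by omega⟩ i C s _

/-- Used for deviations that continue after time `t`, where the continuation loss is only bounded
below. -/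
lemma IsNoise.le_expectedLoss_succ [IsProbabilityMeasure P] (hN : G.IsNoise P ω ε)
    (haI : G.aI = 0) (hbI : G.bI = 0) {π : Profile} (hπ : ∀ i, G.IsMarkovStrategy (π i))
    (i : Fin 2) {t n : ℕ} (ht : 1 ≤ t) (hn : t + n = G.T) {C : QuadraticForm ℝ Reduced}
    (hC : ∀ s, G.ceLoss i (C s.reduced) s ≤ G.expectedLoss P ω ε π i (t + 1) n s) (s : State) :
    G.ceLoss i (G.bellman i C (s.reduced, fun k => π k t s)) s
      ≤ G.expectedLoss P ω ε π i t (n + 1) s := by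
  rw [hN.expectedLoss_succ hπ i ht hn,
    ← hN.lintegral_ceLoss_next haI hbI ⟨ht, by omega⟩ i C s (fun k => π k t s)]
  exact lintegral_mono fun x => hC _

/-- The linear Markov perfect equilibrium. -/
def eqProfile (G : ExecutionGame) : Profile := fun i t s => G.eqOrder (G.T - t) s.reduced i

lemma isMarkovStrategy_eqProfile (G : ExecutionGame) (i : Fin 2) :
    G.IsMarkovStrategy (G.eqProfile i) := fun t _ =>
  (measurable_pi_apply i).comp
    ((G.eqOrder (G.T - t)).continuous_of_finiteDimensional.measurable.comp
      State.measurable_reduced)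

lemma isMarkovStrategy_update {π : Profile} (hπ : ∀ i, G.IsMarkovStrategy (π i)) {i : Fin 2}
    {f : ℕ → State → ℝ} (hf : G.IsMarkovStrategy f) (k : Fin 2) :
    G.IsMarkovStrategy (Function.update π i f k) := by
  by_cases hk : k = i
  · subst hk; simpa using hf
  · simpa [hk] using hπ k

/-- The profile obtained when trader `i` orders according to `g` at time `t`, and follows `π` at
all other times. -/
def deviateAt (π : Profile) (i : Fin 2) (t : ℕ) (g : State → ℝ) : Profile :=
  Function.update π i (Function.update (π i) t g)

lemma isMarkovStrategy_update_at {f : ℕ → State → ℝ} (hf : G.IsMarkovStrategy f) (t : ℕ)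
    {g : State → ℝ} (hg : Measurable g) : G.IsMarkovStrategy (Function.update f t g) := by
  intro u hu
  by_cases h : u = t
  · subst h; simpa using hg
  · simpa [h] using hf u hu

lemma deviateAt_of_ne (π : Profile) (i : Fin 2) {t u : ℕ} (g : State → ℝ) (hu : u ≠ t)
    (k : Fin 2) : deviateAt π i t g k u = π k u := by
  by_cases hk : k = i
  · subst hk; simp [deviateAt, hu]
  · simp [deviateAt, hk]

lemma update_apply_at (π : Profile) (i : Fin 2) (f : ℕ → State → ℝ) (t : ℕ) (s : State) :
    (fun k => Function.update π i f k t s)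
      = Function.update (fun k => π k t s) i (f t s) := by
  funext k
  by_cases hk : k = i
  · subst hk; simp
  · simp [hk]

lemma deviateAt_self (π : Profile) (i : Fin 2) (t : ℕ) (g : State → ℝ) (s : State) :
    (fun k => deviateAt π i t g k t s) = Function.update (fun k => π k t s) i (g s) := by
  rw [deviateAt, update_apply_at]
  simp

/-- Verification: the losses along the linear profile, and a lower bound for the losses of any
deviation. -/
lemma IsNoise.expectedLoss_eqProfile [IsProbabilityMeasure P] (hN : G.IsNoise P ω ε)
    (haI : G.aI = 0) (hbI : G.bI = 0) (i : Fin 2) (n : ℕ) :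
    ∀ t, 1 ≤ t → t + n = G.T → ∀ s,
      G.expectedLoss P ω ε G.eqProfile i t (n + 1) s
        = G.ceLoss i (G.eqCost n i s.reduced) s ∧
      ∀ f, G.IsMarkovStrategy f → G.ceLoss i (G.eqCost n i s.reduced) s
        ≤ G.expectedLoss P ω ε (Function.update G.eqProfile i f) i t (n + 1) s := by
  have hmeas := G.isMarkovStrategy_eqProfile
  induction n with
  | zero =>
    intro t ht hn s
    have hq : ∀ k, G.eqProfile k t s = s.Q k := fun k => by
      simp [eqProfile, show G.T - t = 0 by omega, eqOrder, State.reduced]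
    refine ⟨?_, fun f hf => ?_⟩
    · rw [hN.expectedLoss_one hmeas i ⟨ht, by omega⟩ (by omega)]
      exact G.loss_next_of_eq i s (funext hq) 0 0
    · rw [hN.expectedLoss_one (isMarkovStrategy_update hmeas hf) i ⟨ht, by omega⟩ (by omega),
        update_apply_at]
      by_cases hfs : f t s = s.Q i
      · refine (G.loss_next_of_eq i s ?_ 0 0).ge
        rw [funext hq, hfs, Function.update_eq_self]
      · rw [loss_next, if_neg (by simpa using hfs)]
        exact le_top
  | succ n ih =>
    intro t ht hn s
    have ih := ih (t + 1) (by omega) (by omega)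
    have hq : (fun k => G.eqProfile k t s) = G.eqOrder (n + 1) s.reduced := by
      funext k
      simp [eqProfile, show G.T - t = n + 1 by omega]
    refine ⟨?_, fun f hf => ?_⟩
    · rw [hN.expectedLoss_succ_eq haI hbI hmeas i ht hn (fun s => (ih s).1), hq,
        ← eqCost_succ_apply]
    · refine le_trans ?_ (hN.le_expectedLoss_succ haI hbI (isMarkovStrategy_update hmeas hf) i ht
        hn (fun s => (ih s).2 f hf) s)
      -- At a fixed state the deviation is just a number, to which the stage equilibrium inequality
      -- applies.
      rw [ceLoss_le_ceLoss_iff, update_apply_at, hq, eqCost_succ_apply]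
      exact (G.isStageEquilibrium_eqCost_iff n s.reduced _).2 rfl i (f t s)

lemma IsNoise.isMarkovPerfect_eqProfile [IsProbabilityMeasure P] (hN : G.IsNoise P ω ε)
    (haI : G.aI = 0) (hbI : G.bI = 0) : G.IsMarkovPerfect P ω ε G.eqProfile where
  markov := G.isMarkovStrategy_eqProfile
  optimal t ht s i f hf := by
    have hT := ht.2
    have h := hN.expectedLoss_eqProfile haI hbI i (G.T - t) t ht.1 (by omega) s
    rw [value_le_value_iff, show G.T + 1 - t = G.T - t + 1 by omega, h.1]
    exact h.2 f hf

/-- At a Markov perfect equilibrium no trader gains by a deviation at a single time. -/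
lemma IsMarkovPerfect.expectedLoss_le_deviateAt {π : Profile} (hπ : G.IsMarkovPerfect P ω ε π)
    (i : Fin 2) {t n : ℕ} (ht : 1 ≤ t) (hn : t + n = G.T) {g : State → ℝ} (hg : Measurable g)
    (s : State) :
    G.expectedLoss P ω ε π i t (n + 1) s
      ≤ G.expectedLoss P ω ε (deviateAt π i t g) i t (n + 1) s := by
  have h := hπ.optimal t ⟨ht, by omega⟩ s i _ (isMarkovStrategy_update_at (hπ.markov i) t hg)
  rwa [value_le_value_iff, show G.T + 1 - t = n + 1 by omega] at h

/-- Every Markov perfect equilibrium is the linear one. -/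
lemma IsMarkovPerfect.eq_eqOrder [IsProbabilityMeasure P] {π : Profile}
    (hπ : G.IsMarkovPerfect P ω ε π) (hN : G.IsNoise P ω ε) (haI : G.aI = 0) (hbI : G.bI = 0)
    (n : ℕ) : ∀ t, 1 ≤ t → t + n = G.T → ∀ s,
      (fun k => π k t s) = G.eqOrder n s.reduced ∧
      ∀ i, G.expectedLoss P ω ε π i t (n + 1) s = G.ceLoss i (G.eqCost n i s.reduced) s := by
  have hdev : ∀ i t {g : State → ℝ}, Measurable g →
      ∀ k, G.IsMarkovStrategy (deviateAt π i t g k) := fun i t g hg =>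
    isMarkovStrategy_update hπ.markov (isMarkovStrategy_update_at (hπ.markov i) t hg)
  induction n with
  | zero =>
    intro t ht hn s
    have htT : t ∈ Set.Icc 1 G.T := ⟨ht, by omega⟩
    have hq : (fun k => π k t s) = s.Q := by
      funext i
      by_contra hne
      -- Liquidating everything gives a finite loss, against an infinite one otherwise.
      have h := hπ.expectedLoss_le_deviateAt i ht hn (measurable_const (a := s.Q i)) s
      rw [hN.expectedLoss_one hπ.markov i htT (by omega), loss_next, if_neg hne,
        hN.expectedLoss_one (hdev i t measurable_const) i htT (by omega), deviateAt_self, loss_next,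
        if_pos (by simp)] at h
      exact ENNReal.ofReal_ne_top (top_le_iff.1 h)
    refine ⟨hq, fun i => ?_⟩
    rw [hN.expectedLoss_one hπ.markov i htT (by omega)]
    exact G.loss_next_of_eq i s hq 0 0
  | succ n ih =>
    intro t ht hn s
    have ih := ih (t + 1) (by omega) (by omega)
    have hloss := fun i =>
      hN.expectedLoss_succ_eq haI hbI hπ.markov i ht hn (fun s => (ih s).2 i) s
    have hq : (fun k => π k t s) = G.eqOrder (n + 1) s.reduced := by
      rw [← isStageEquilibrium_eqCost_iff]
      intro i y
      -- Since `π` is unchanged after time `t`, the continuation losses of the induction hypothesis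
      -- still apply, and comparing losses becomes comparing stage costs.
      have h := hπ.expectedLoss_le_deviateAt i ht hn (measurable_const (a := y)) s
      rw [hloss, hN.expectedLoss_succ_eq haI hbI (hdev i t measurable_const) i ht hn
        (fun s => (G.expectedLoss_congr P ω ε (fun u hu k =>
          deviateAt_of_ne π i _ (by have := hu.1; omega) k) i s).trans ((ih s).2 i)),
        deviateAt_self, ceLoss_le_ceLoss_iff] at h
      exact h
    refine ⟨hq, fun i => ?_⟩
    rw [hloss, hq, ← eqCost_succ_apply]

/-- A linear map on the reduced states in coordinates. -/
lemma linearMap_reduced_apply (φ : Reduced →ₗ[ℝ] (Fin 2 → ℝ)) (s : State) (i : Fin 2) :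
    φ s.reduced i = φ (Pi.single i 1, 0) i * s.Q i
      + φ (Pi.single (other i) 1, 0) i * s.Q (other i) + φ (0, 1) i * s.R := by
  have h : s.reduced = s.Q i • ((Pi.single i 1, 0) : Reduced)
      + s.Q (other i) • ((Pi.single (other i) 1, 0) : Reduced) + s.R • ((0, 1) : Reduced) := by
    refine Prod.ext (funext fun k => ?_) (by simp [State.reduced])
    fin_cases i <;> fin_cases k <;> simp [State.reduced, other]
  rw [h]
  simp only [map_add, map_smul, Pi.add_apply, Pi.smul_apply, smul_eq_mul]
  ring

end
end ExecutionGame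

theorem proposition4p1 (G : ExecutionGame) (haI : G.aI = 0) (hbI : G.bI = 0) :
    ∃ a b c d : Fin 2 → ℕ → ℝ,
      ∀ (Ω : Type*) [MeasurableSpace Ω] (P : Measure Ω) [IsProbabilityMeasure P]
        (ω ε : ℕ → Ω → ℝ), G.IsNoise P ω ε →
        (∃ π, G.IsMarkovPerfect P ω ε π) ∧
        ∀ π, G.IsMarkovPerfect P ω ε π → ∀ i, ∀ t ∈ Set.Icc 1 G.T, ∀ s : ExecutionGame.State,
          π i t s = a i t + b i t * s.Q i + c i t * s.Q (ExecutionGame.other i) + d i t * s.R ∧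
          ∀ x : ℝ, π i t { s with I := x } = π i t s := by
  -- The intercept is zero because the costs are purely quadratic; the other coefficients are values
  -- of the linear equilibrium order on basis vectors.
  refine ⟨fun _ _ => 0, fun i t => G.eqOrder (G.T - t) (Pi.single i 1, 0) i,
    fun i t => G.eqOrder (G.T - t) (Pi.single (ExecutionGame.other i) 1, 0) i,
    fun i t => G.eqOrder (G.T - t) (0, 1) i, fun Ω _ P _ ω ε hN =>
      ⟨⟨G.eqProfile, hN.isMarkovPerfect_eqProfile haI hbI⟩, fun π hπ i t ht s => ?_⟩⟩
  have hT := ht.2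
  have h : ∀ s', π i t s' = G.eqOrder (G.T - t) s'.reduced i := fun s' =>
    congrFun (hπ.eq_eqOrder hN haI hbI (G.T - t) t ht.1 (by omega) s').1 i
  refine ⟨?_, fun x => ?_⟩
  · rw [h, ExecutionGame.linearMap_reduced_apply, zero_add]
  · rw [h, h]
    rfl
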